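/- Let $m\in\mathbb N$, let $c_1>0$, and let $H\in\mathbb R^{m\times m}$ be symmetric with $H_{ii}>0$ and $H_{ii}>\sum_{j\neq i}|H_{ij}|$ for all $i$ (so $H$ is positive definite); let $\lambda_{\max}(H)=\|H\|$ be its largest eigenvalue. Let the agent trajectory $y:\mathbb R\to\mathbb R^m$ be twice differentiable and the source trajectory $x:\mathbb R\to\mathbb R^m$ differentiable, with $$\|y(t)\|\le M_1,\quad \|\dot y(t)\|\le M_2,\quad \|\ddot y(t)\|\le M_3,\quad \|x(t)\|\le M_4,\quad \|\dot x(t)\|\le\varepsilon\qquad(t\in\mathbb R)$$ for some $M_1,M_2,M_3,M_4,\varepsilon>0$. Put $F(t)=c_1-\tfrac12(y(t)-x(t))^{T}H(y(t)-x(t))$ and, in $\mathbb R^{m(m+3)/2}$, $$\theta^*(t)=\big[H_{11},H_{12},\dots,H_{1m},H_{22},\dots,H_{mm},\,(Hx(t))^{T}\big]^{T},\qquad \Psi(t)=\big[-\tfrac12y_1^2,-y_1y_2,\dots,-y_1y_m,-\tfrac12y_2^2,\dots,-\tfrac12y_m^2,\,y^{T}\big]^{T}.$$ For $a>0$ define,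 on $t\ge 0$, the filtered signals $$\dot\xi_1=-a\xi_1+F,\ \ \xi_1(0)=0,\ \ z=-a\xi_1+F;\qquad \dot\xi_2=-a\xi_2+\Psi,\ \ \xi_2(0)=0,\ \ \phi=-a\xi_2+\Psi.$$ Write $\theta=(\theta_H,\theta_x)$ with $\theta_H\in\mathbb R^{m(m+1)/2}$, $\theta_x\in\mathbb R^m$. Let $S_H\subseteq\mathbb R^{m(m+1)/2}$ be a convex set (for example a compact one) that contains $\theta_H^*$ and consists of vectors $[\hat H_{11},\hat H_{12},\dots,\hat H_{mm}]^T$ whose symmetric matrices $\hat H$ satisfy $\hat H_{ii}>0$ and $\hat H_{ii}>\sum_{j\ne i}|\hat H_{ij}|$ for all $i$. For $\gamma>0$ let $\hat\theta$ be a solution on $[0,\infty)$ of the projected adaptive law $$\dot{\hat\theta}=\operatorname*{Proj}_{\hat\theta_H\in S_H}\{\gamma\phi(z-\hat\theta^{T}\phi)\},$$ that is, $\hat\theta$ is absolutely continuous on compact intervals, $\hat\theta_H(t)\in S_H$ for all $t\ge0$, and the equation holds for almost every $t\geq 0$, where $\mathrm{Proj}$ replaces the $\theta_H$-block of its argument by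 the nearest point in the tangent cone of $S_H$ at $\hat\theta_H(t)$ and leaves the $\theta_x$-block unchanged. Suppose that for some $\alpha_1,\alpha_2,T>0$ $$\alpha_1 I\le\int_t^{t+T}\phi(\tau)\phi(\tau)^{T}\,d\tau\le\alpha_2 I\qquad\text{for all }t\ge0 .$$ Then $$\limsup_{t\to\infty}\|\hat\theta(t)-\theta^*(t)\|\le K\,\lambda_{\max}(H)\,\varepsilon ,$$ where the constant $K>0$ depends only on $M_1,M_2,M_4,\gamma,a,T,\alpha_1$ and $\alpha_2$. -/

import Mathlib

open Filter MeasureTheory Set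
open scoped Topology

noncomputable section

/-- The index pairs `(i, j)` with `i ≤ j` of the entries on and above the diagonal of a symmetric
`m × m` matrix. -/
abbrev UpperIdx (m : ℕ) : Type := {p : Fin m × Fin m // p.1 ≤ p.2}

/-- The space of the vectors `(H₁₁, H₁₂, …, H₁ₘ, H₂₂, …, Hₘₘ)`, of dimension `m (m + 1) / 2`, with
the Euclidean norm. -/
abbrev HVec (m : ℕ) : Type := EuclideanSpace ℝ (UpperIdx m)

/-- The parameter space, of dimension `m (m + 3) / 2`, with the Euclidean norm: the entries of a
symmetric matrix, followed by a vector of `ℝᵐ`. -/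
abbrev ParamVec (m : ℕ) : Type := EuclideanSpace ℝ (UpperIdx m ⊕ Fin m)

/-- The block `θ_H` of a parameter vector `θ = (θ_H, θ_x)`. -/
def hessPart {m : ℕ} (θ : ParamVec m) : HVec m :=
  WithLp.toLp 2 fun p => θ (Sum.inl p)

/-- The block `θ_x` of a parameter vector `θ = (θ_H, θ_x)`. -/
def locPart {m : ℕ} (θ : ParamVec m) : EuclideanSpace ℝ (Fin m) :=
  WithLp.toLp 2 fun i => θ (Sum.inr i)

/-- The vector `(H₁₁, H₁₂, …, H₁ₘ, H₂₂, …, Hₘₘ)` of the entries of `H`. -/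
def hessVec {m : ℕ} (H : Matrix (Fin m) (Fin m) ℝ) : HVec m :=
  WithLp.toLp 2 fun p => H p.1.1 p.1.2

/-- The symmetric matrix with a given vector of entries on and above the diagonal. -/
def symmMatrix {m : ℕ} (v : HVec m) : Matrix (Fin m) (Fin m) ℝ :=
  Matrix.of fun i j => v ⟨(min i j, max i j), min_le_max⟩

/-- Positive diagonal and strict diagonal dominance. -/
def IsPosDiagDominant {m : ℕ} (H : Matrix (Fin m) (Fin m) ℝ) : Prop :=
  (∀ i, 0 < H i i) ∧ ∀ i, ∑ j ∈ Finset.univ.erase i, |H i j| < |H i i|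

/-- The quadratic signal field `c₁ - (y - x)ᵀ H (y - x) / 2` with extremum at `x`, evaluated
at `y`. -/
def signalField {m : ℕ} (c₁ : ℝ) (H : Matrix (Fin m) (Fin m) ℝ)
    (x y : EuclideanSpace ℝ (Fin m)) : ℝ :=
  c₁ - 1 / 2 * ((y - x).ofLp ⬝ᵥ H.mulVec (y - x).ofLp)

/-- The true parameter `θ* = (H₁₁, H₁₂, …, Hₘₘ, H x)` for the extremum location `x`. -/
def trueParam {m : ℕ} (H : Matrix (Fin m) (Fin m) ℝ) (x : EuclideanSpace ℝ (Fin m)) :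
    ParamVec m :=
  WithLp.toLp 2 (Sum.elim (fun p => H p.1.1 p.1.2) (H.mulVec x.ofLp))

/-- The vector `Ψ = (-y₁² / 2, -y₁ y₂, …, -y₁ yₘ, -y₂² / 2, …, -yₘ² / 2, y)`. -/
def regressor {m : ℕ} (y : EuclideanSpace ℝ (Fin m)) : ParamVec m :=
  WithLp.toLp 2 (Sum.elim
    (fun p => if p.1.1 = p.1.2 then -(1 / 2) * y p.1.1 ^ 2 else -(y p.1.1 * y p.1.2))
    fun i => y i)

section Filtering

variable {E : Type*} [NormedAddCommGroup E] [NormedSpace ℝ E]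

/-- `ξ` is the state, on `t ≥ 0`, of the filter `ξ' = -a ξ + u`, `ξ(0) = 0`, with input `u`. -/
def IsFilterState (a : ℝ) (u ξ : ℝ → E) : Prop :=
  ξ 0 = 0 ∧ ∀ t, 0 ≤ t → HasDerivWithinAt ξ (-a • ξ t + u t) (Ici 0) t

/-- The output `-a ξ + u` of the filter with state `ξ` and input `u`. -/
def filterOutput (a : ℝ) (u ξ : ℝ → E) (t : ℝ) : E :=
  -a • ξ t + u t

end Filtering

/-- `∫ φ(τ) φ(τ)ᵀ dτ` over `[t, t + T]`. -/
def gramMatrix {m : ℕ} (φ : ℝ → ParamVec m) (T t : ℝ) :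
    Matrix (UpperIdx m ⊕ Fin m) (UpperIdx m ⊕ Fin m) ℝ :=
  Matrix.of fun i j => ∫ τ in t..(t + T), φ τ i * φ τ j

/-- Persistent excitation: `α₁ I ≤ ∫ φ(τ) φ(τ)ᵀ dτ ≤ α₂ I` over `[t, t + T]`, for all `t ≥ 0`, in
the order of positive semidefiniteness. -/
def IsPersistentlyExciting {m : ℕ} (φ : ℝ → ParamVec m) (T α₁ α₂ : ℝ) : Prop :=
  ∀ t, 0 ≤ t →
    (gramMatrix φ T t - α₁ • (1 : Matrix (UpperIdx m ⊕ Fin m) (UpperIdx m ⊕ Fin m) ℝ)).PosSemidef ∧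
    (α₂ • (1 : Matrix (UpperIdx m ⊕ Fin m) (UpperIdx m ⊕ Fin m) ℝ) - gramMatrix φ T t).PosSemidef

/-- `w = Proj {v}` at the parameter `θ`: the block of `v` that belongs to `θ_H` is replaced by its
nearest point in the tangent cone of `S` at `θ_H`, and the block that belongs to `θ_x` is kept. -/
def IsParamProj {m : ℕ} (S : Set (HVec m)) (θ v w : ParamVec m) : Prop :=
  hessPart w ∈ posTangentConeAt S (hessPart θ) ∧
  (∀ u ∈ posTangentConeAt S (hessPart θ),
    ‖hessPart v - hessPart w‖ ≤ ‖hessPart v - u‖) ∧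
  locPart w = locPart v

/-- `θ` solves, on `t ≥ 0`, the gradient law with parameter projection
`θ' = Proj {γ φ (z - θᵀ φ)}`, in the sense of Carathéodory: it is absolutely continuous on compact
intervals, its block `θ_H` stays in `S`, and the equation holds at almost every time. -/
structure IsProjectedGradientSolution {m : ℕ} (γ : ℝ) (S : Set (HVec m)) (z : ℝ → ℝ)
    (φ θ : ℝ → ParamVec m) : Prop where
  absCont : ∀ b, 0 ≤ b → AbsolutelyContinuousOnInterval θ 0 b
  mem : ∀ t, 0 ≤ t → hessPart (θ t) ∈ S
  ode : ∀ᵐ t ∂(volume.restrict (Ici (0 : ℝ))), ∃ w : ParamVec m,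
    HasDerivAt θ w t ∧ IsParamProj S (θ t) (γ • (z t - inner ℝ (θ t) (φ t)) • φ t) w

end

/-! Write `e = θhat - θ*`, `s = eᵀφ`, `q = z - θ*ᵀφ` and `λ = ‖H‖`. The argument is an energy
estimate for `‖e‖²` over windows of length `T`.

The law gives `e' = Proj {γ φ (q - s)} - (0, H x')`. Since `S` is convex and contains `θ*_H`, the
projection does not increase `⟨e, e'⟩` (`IsParamProj.inner_sub_le`); since it projects onto a cone,
it does not lengthen the velocity (`IsParamProj.norm_le`). Hence `(‖e‖²)' / 2 ≤ -γ s² + γ |s| |q| +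
λ ε ‖e‖` almost everywhere.

The mismatch `q` is small because `F - θ*ᵀΨ` depends on `x` alone and so varies at rate `O(λ ε)`: up
to an exponentially decaying transient, filtering leaves only its rate of change and that of `θ*`
(`abs_filterOutput_sub_inner_le`).

The dissipation `∫ s²` also limits how far `e` moves in a window, so excitation in the frozen
direction `e t` forces dissipation along the moving `e`. This yields `‖e (t + T)‖² ≤ (1 - κ) ‖e t‖²
+ C l²` with `l = λ ε + η` (`exists_contraction_of_excitation`). Iterating and letting `η → 0` gives
the bound, with `κ` and `C` independent of `m`, `H` and `ε`. -/

/-! ### Projection onto the tangent cone of a convex set -/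

section TangentCone

variable {E : Type*} [NormedAddCommGroup E]

/-- This supplies the variations `w + s • (y - x)` against which the nearest point of the cone is
tested. Convexity lets a step approximating `w` be mixed with a step towards `y` and remain in `S`.
-/
theorem Convex.add_smul_sub_mem_posTangentConeAt [NormedSpace ℝ E] {S : Set E} (hS : Convex ℝ S)
    {x y w : E} (hx : x ∈ S) (hy : y ∈ S) (hw : w ∈ posTangentConeAt S x) {s : ℝ} (hs : 0 < s) :
    w + s • (y - x) ∈ posTangentConeAt S x := by
  obtain ⟨α, l, hl, c, d, hd, hmem, hcd⟩ := exists_fun_of_mem_tangentConeAt hw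
  lift s to NNReal using hs.le
  -- The scaling `C` makes the perturbed point a convex combination of `x + d`, `y` and `x` with
  -- weights `c / C`, `s / C`, `(n + 1) / C`. The term `n + 1`, sent to infinity along `atTop`,
  -- makes the step towards `y` vanish even if `c` stays bounded.
  let C : α × ℕ → NNReal := fun p => c p.1 + s + (p.2 + 1)
  have hCv : ∀ p, (C p : ℝ) = c p.1 + s + (p.2 + 1) := fun p => by simp [C]
  have hC : ∀ p, 0 < (C p : ℝ) := fun p => by rw [hCv]; positivity
  refine mem_tangentConeAt_of_seq (l ×ˢ atTop) C
    (fun p => ((c p.1 : ℝ) / C p) • d p.1 + ((s : ℝ) / C p) • (y - x)) ?_ ?_ ?_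
  · have h1 : Tendsto (fun p : α × ℕ => ((c p.1 : ℝ) / C p) • d p.1) (l ×ˢ atTop) (𝓝 0) := by
      refine squeeze_zero_norm (a := fun p : α × ℕ => ‖d p.1‖) (fun p => ?_) ?_
      · rw [norm_smul, Real.norm_of_nonneg (by positivity)]
        refine mul_le_of_le_one_left (norm_nonneg _) ?_
        rw [div_le_one (hC p), hCv]
        have : (0 : ℝ) ≤ p.2 := Nat.cast_nonneg _
        linarith
      · simpa [Function.comp_def] using
          hd.norm.comp (tendsto_fst (f := l) (g := (atTop : Filter ℕ)))
    have h2 : Tendsto (fun p : α × ℕ => ((s : ℝ) / C p) • (y - x)) (l ×ˢ atTop) (𝓝 0) := by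
      refine squeeze_zero_norm (a := fun p : α × ℕ => (s * (1 / ((p.2 : ℝ) + 1))) * ‖y - x‖)
        (fun p => ?_) ?_
      · rw [norm_smul, Real.norm_of_nonneg (by positivity), mul_one_div, hCv]
        refine mul_le_mul_of_nonneg_right (div_le_div_of_nonneg_left hs.le (by positivity) ?_)
          (norm_nonneg _)
        have : (0 : ℝ) ≤ c p.1 := (c p.1).2
        linarith
      · have h3 : Tendsto (fun n : ℕ => ((s : ℝ) * (1 / ((n : ℝ) + 1))) * ‖y - x‖) atTop (𝓝 0) := by
          simpa using
            ((tendsto_one_div_add_atTop_nhds_zero_nat (𝕜 := ℝ)).const_mul (s : ℝ)).mul_const ‖y - x‖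
        exact h3.comp tendsto_snd
    simpa using h1.add h2
  · have h1 : ∀ᶠ p : α × ℕ in l ×ˢ atTop, x + d p.1 ∈ S := tendsto_fst.eventually hmem
    filter_upwards [h1] with p hp
    have hsum : (c p.1 : ℝ) / C p + s / C p + (p.2 + 1) / C p = 1 := by
      rw [← add_div, ← add_div, ← hCv, div_self (hC p).ne']
    have key : x + (((c p.1 : ℝ) / C p) • d p.1 + ((s : ℝ) / C p) • (y - x))
        = ((c p.1 : ℝ) / C p) • (x + d p.1) + ((s : ℝ) / C p) • y
          + (((p.2 : ℝ) + 1) / C p) • x := by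
      rw [eq_sub_of_add_eq' hsum]
      module
    rw [key]
    have := hS.sum_mem (t := Finset.univ)
      (w := ![(c p.1 : ℝ) / C p, (s : ℝ) / C p, ((p.2 : ℝ) + 1) / C p])
      (z := ![x + d p.1, y, x]) ?_ ?_ ?_
    · simpa [Fin.sum_univ_three] using this
    · intro i _
      fin_cases i <;> simp <;> positivity
    · simpa [Fin.sum_univ_three] using hsum
    · intro i _
      fin_cases i <;> simp [hp, hy, hx]
  · have h1 : Tendsto (fun p : α × ℕ => c p.1 • d p.1 + (s : ℝ) • (y - x)) (l ×ˢ atTop)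
        (𝓝 (w + (s : ℝ) • (y - x))) := (hcd.comp tendsto_fst).add_const _
    refine h1.congr fun p => ?_
    have hC' := (hC p).ne'
    rw [NNReal.smul_def, NNReal.smul_def, smul_add, smul_smul, smul_smul,
      mul_div_cancel₀ _ hC', mul_div_cancel₀ _ hC']

theorem smul_mem_posTangentConeAt [NormedSpace ℝ E] {S : Set E} {x w : E}
    (hw : w ∈ posTangentConeAt S x) {r : ℝ} (hr : 0 ≤ r) : r • w ∈ posTangentConeAt S x := by
  obtain ⟨α, l, hl, c, d, hd, hmem, hcd⟩ := exists_fun_of_mem_tangentConeAt hw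
  lift r to NNReal using hr
  refine mem_tangentConeAt_of_seq l (fun n => r * c n) d hd hmem ?_
  simpa [mul_smul, NNReal.smul_def] using hcd.const_smul r

theorem inner_sub_le_zero_of_forall_norm_sub_le [InnerProductSpace ℝ E] {v w u : E}
    (h : ∀ s : ℝ, 0 < s → s < 1 → ‖v - w‖ ≤ ‖v - (w + s • u)‖) : inner ℝ (v - w) u ≤ 0 := by
  by_contra! hpos
  have hu : 0 < ‖u‖ ^ 2 := by
    have : u ≠ 0 := by rintro rfl; simp at hpos
    positivity
  set i := inner ℝ (v - w) u with hi
  obtain ⟨s, hs0, hs⟩ : ∃ s : ℝ, 0 < s ∧ s < min 1 (2 * i / ‖u‖ ^ 2) :=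
    exists_between (by positivity)
  have h1 := h s hs0 (hs.trans_le (min_le_left _ _))
  have h2 : ‖v - (w + s • u)‖ ^ 2 = ‖v - w‖ ^ 2 - 2 * s * i + s ^ 2 * ‖u‖ ^ 2 := by
    rw [← sub_sub, norm_sub_sq_real, inner_smul_right, norm_smul, Real.norm_of_nonneg hs0.le]
    ring
  have h3 : s * ‖u‖ ^ 2 < 2 * i := by
    rw [← lt_div_iff₀ hu]
    exact hs.trans_le (min_le_right _ _)
  have h4 : ‖v - w‖ ^ 2 ≤ ‖v - (w + s • u)‖ ^ 2 := by gcongr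
  nlinarith

/-- The nearest point `w` to `v` in the tangent cone at `x` of a convex set satisfies the
variational inequality. -/
theorem Convex.inner_sub_posTangentConeAt_proj_le [InnerProductSpace ℝ E] {S : Set E}
    (hS : Convex ℝ S) {x y v w : E} (hx : x ∈ S) (hy : y ∈ S) (hw : w ∈ posTangentConeAt S x)
    (hmin : ∀ u ∈ posTangentConeAt S x, ‖v - w‖ ≤ ‖v - u‖) : inner ℝ (v - w) (y - x) ≤ 0 :=
  inner_sub_le_zero_of_forall_norm_sub_le fun _ hs _ =>
    hmin _ (hS.add_smul_sub_mem_posTangentConeAt hx hy hw hs)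

/-- Shrinking `w` towards `0` stays in the cone, so minimality gives `⟨v - w, w⟩ ≥ 0`, that is `‖w‖²
≤ ⟨v, w⟩`. Only invariance under scaling matters here, not convexity. -/
theorem norm_posTangentConeAt_proj_le [InnerProductSpace ℝ E] {S : Set E} {x v w : E}
    (hw : w ∈ posTangentConeAt S x)
    (hmin : ∀ u ∈ posTangentConeAt S x, ‖v - w‖ ≤ ‖v - u‖) : ‖w‖ ≤ ‖v‖ := by
  have h : inner ℝ (v - w) (-w) ≤ 0 := by
    refine inner_sub_le_zero_of_forall_norm_sub_le fun s _ hs1 => hmin _ ?_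
    convert smul_mem_posTangentConeAt hw (sub_nonneg.mpr hs1.le) using 1
    module
  rw [inner_neg_right, inner_sub_left, real_inner_self_eq_norm_sq] at h
  have h2 := real_inner_le_norm v w
  by_contra! hlt
  nlinarith [norm_nonneg v, norm_nonneg w]

end TangentCone

/-! ### Integral bounds for absolutely continuous curves -/

section AbsolutelyContinuous

theorem LipschitzWith.comp_absolutelyContinuousOnInterval {X Y : Type*} [PseudoMetricSpace X]
    [PseudoMetricSpace Y] {K : NNReal} {g : X → Y} (hg : LipschitzWith K g) {f : ℝ → X} {a b : ℝ}
    (hf : AbsolutelyContinuousOnInterval f a b) :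
    AbsolutelyContinuousOnInterval (fun t => g (f t)) a b := by
  refine squeeze_zero (fun t => Finset.sum_nonneg fun i _ => dist_nonneg) (fun t => ?_)
    (by simpa using Tendsto.const_mul (K : ℝ) hf)
  rw [Finset.mul_sum]
  exact Finset.sum_le_sum fun i _ => hg.dist_le_mul _ _

theorem AbsolutelyContinuousOnInterval.sub_le_integral {f h : ℝ → ℝ} {a b : ℝ} (hab : a ≤ b)
    (hf : AbsolutelyContinuousOnInterval f a b) (hh : IntervalIntegrable h volume a b)
    (hle : ∀ᵐ t, t ∈ Icc a b → deriv f t ≤ h t) : f b - f a ≤ ∫ t in a..b, h t := by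
  rw [← hf.integral_deriv_eq_sub]
  refine intervalIntegral.integral_mono_ae_restrict hab hf.intervalIntegrable_deriv hh ?_
  exact (ae_restrict_iff' measurableSet_Icc).mpr hle

theorem AbsolutelyContinuousOnInterval.norm_sub_le_integral {E : Type*} [NormedAddCommGroup E]
    [InnerProductSpace ℝ E] {e : ℝ → E} {h : ℝ → ℝ} {a b : ℝ} (hab : a ≤ b)
    (he : AbsolutelyContinuousOnInterval e a b) (hh : IntervalIntegrable h volume a b)
    (hle : ∀ᵐ t, t ∈ Icc a b → ∃ w, HasDerivAt e w t ∧ ‖w‖ ≤ h t) :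
    ‖e b - e a‖ ≤ ∫ t in a..b, h t := by
  -- Pairing with the fixed vector `u` reduces the claim to the scalar case; dividing by `‖u‖` then
  -- gives the norm bound.
  set u := e b - e a with hu
  have hac : AbsolutelyContinuousOnInterval (fun t => inner ℝ u (e t)) a b :=
    (innerSL ℝ u).lipschitz.comp_absolutelyContinuousOnInterval he
  have h1 := hac.sub_le_integral hab (hh.const_mul ‖u‖) (by
    filter_upwards [hle] with t ht hmem
    obtain ⟨w, hw, hwh⟩ := ht hmem
    have h2 : HasDerivAt (fun t => inner ℝ u (e t)) (inner ℝ u w) t :=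
      (innerSL ℝ u).hasFDerivAt.comp_hasDerivAt t hw
    rw [h2.deriv]
    exact (real_inner_le_norm u w).trans (by gcongr))
  rw [← inner_sub_right, ← hu, real_inner_self_eq_norm_sq, intervalIntegral.integral_const_mul] at h1
  rcases (norm_nonneg u).eq_or_lt with h0 | h0
  · rw [← h0]
    refine intervalIntegral.integral_nonneg_of_ae_restrict hab ?_
    refine (ae_restrict_iff' measurableSet_Icc).mpr ?_
    filter_upwards [hle] with t ht hmem
    obtain ⟨w, _, hwh⟩ := ht hmem
    exact (norm_nonneg w).trans hwh
  · nlinarith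

end AbsolutelyContinuous

/-! ### Stable first-order linear filters -/

section LinearFilter

variable {E : Type*} [NormedAddCommGroup E] [NormedSpace ℝ E]

theorem norm_le_of_stable_filter {a b : ℝ} (ha : 0 < a) {q h : ℝ → E}
    (hq : ∀ t, 0 ≤ t → HasDerivWithinAt q (-a • q t + h t) (Ici 0) t)
    (hh : ∀ t, 0 ≤ t → ‖h t‖ ≤ b) {t : ℝ} (ht : 0 ≤ t) :
    ‖q t‖ ≤ Real.exp (-(a * t)) * ‖q 0‖ + b / a := by
  have hexp : ∀ s : ℝ, HasDerivAt (fun s => Real.exp (a * s)) (Real.exp (a * s) * a) s := fun s => by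
    simpa using ((hasDerivAt_id s).const_mul a).exp
  have hb : 0 ≤ b := (norm_nonneg _).trans (hh 0 le_rfl)
  have hderiv : ∀ s, 0 ≤ s →
      HasDerivWithinAt (fun s => Real.exp (a * s) • q s) (Real.exp (a * s) • h s) (Ici 0) s := by
    intro s hs
    refine ((hexp s).hasDerivWithinAt.fun_smul (hq s hs)).congr_deriv ?_
    module
  -- The integrating factor `exp (a s)` removes the damping term; the boundary function is the
  -- integral of the bound `b * exp (a s)`, started at `‖q 0‖`.
  have key := image_norm_le_of_norm_deriv_right_le_deriv_boundary (a := 0) (b := t)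
    (f := fun s => Real.exp (a * s) • q s) (f' := fun s => Real.exp (a * s) • h s)
    (B := fun s => ‖q 0‖ + b / a * (Real.exp (a * s) - 1))
    (B' := fun s => b / a * (Real.exp (a * s) * a))
    (fun s hs => ((hderiv s hs.1).continuousWithinAt).mono Icc_subset_Ici_self)
    (fun s hs => (hderiv s hs.1).mono (Ici_subset_Ici.mpr hs.1))
    (by simp)
    (fun s => (((hexp s).sub_const 1).const_mul _).const_add _)
    (fun s hs => by
      rw [norm_smul, Real.norm_of_nonneg (Real.exp_pos _).le]
      have := hh s hs.1
      calc Real.exp (a * s) * ‖h s‖ ≤ Real.exp (a * s) * b := by gcongr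
        _ = _ := by field_simp)
    (right_mem_Icc.mpr ht)
  rw [norm_smul, Real.norm_of_nonneg (Real.exp_pos _).le] at key
  have h1 : ‖q t‖ ≤ Real.exp (-(a * t)) * (‖q 0‖ + b / a * (Real.exp (a * t) - 1)) := by
    rw [Real.exp_neg, ← div_eq_inv_mul, le_div_iff₀ (Real.exp_pos _)]
    linarith
  have h2 : Real.exp (-(a * t)) * Real.exp (a * t) = 1 := by rw [← Real.exp_add]; simp
  have h3 : 0 ≤ b / a * Real.exp (-(a * t)) := by positivity
  linear_combination h1 + h3 + b / a * h2

end LinearFilter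

/-! ### Iterating a contraction over time shifts -/

section Iteration

/-- `C / κ` is the fixed point of `r ↦ (1 - κ) r + C`, and the excess over it shrinks by `1 - κ` at
each shift. Every later time is a shift by a multiple of `T` from the first window, where `f` is
bounded. -/
theorem eventually_le_of_contracting_shift {f : ℝ → ℝ} {t₀ T κ C : ℝ} (hT : 0 < T) (hκ : 0 < κ)
    (hκ₁ : κ < 1) (hbdd : BddAbove (f '' Icc t₀ (t₀ + T)))
    (hf : ∀ t, t₀ ≤ t → f (t + T) ≤ (1 - κ) * f t + C) {η : ℝ} (hη : 0 < η) :
    ∀ᶠ t in atTop, f t ≤ C / κ + η := by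
  obtain ⟨B, hB⟩ := hbdd
  have hiter : ∀ n : ℕ, ∀ s ∈ Icc t₀ (t₀ + T),
      f (s + n * T) ≤ (1 - κ) ^ n * |B - C / κ| + C / κ := by
    intro n
    induction n with
    | zero =>
      intro s hs
      have := hB (mem_image_of_mem f hs)
      have h2 := le_abs_self (B - C / κ)
      simp only [Nat.cast_zero, zero_mul, add_zero, pow_zero, one_mul]
      linarith
    | succ n ih =>
      intro s hs
      have h1 := hf (s + n * T) (by have := hs.1; have : 0 ≤ n * T := by positivity
                                    linarith)
      have h2 := mul_le_mul_of_nonneg_left (ih s hs) (sub_nonneg.mpr hκ₁.le)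
      have h3 : s + ((n + 1 : ℕ) : ℝ) * T = s + n * T + T := by push_cast; ring
      have h4 : (1 - κ) * (C / κ) + C = C / κ := by field_simp; ring
      rw [h3, pow_succ]
      linarith
  have hlim : Tendsto (fun n : ℕ => (1 - κ) ^ n * |B - C / κ|) atTop (𝓝 0) := by
    simpa using (tendsto_pow_atTop_nhds_zero_of_lt_one (sub_nonneg.mpr hκ₁.le)
      (by linarith : 1 - κ < 1)).mul_const |B - C / κ|
  obtain ⟨N, hN⟩ := eventually_atTop.mp (hlim.eventually_lt_const hη)
  filter_upwards [eventually_ge_atTop (t₀ + N * T)] with t ht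
  have ht₀ : 0 ≤ (t - t₀) / T := by
    have : 0 ≤ N * T := by positivity
    exact div_nonneg (by linarith) hT.le
  set n := ⌊(t - t₀) / T⌋₊ with hn
  have hn1 : n * T ≤ t - t₀ := by
    rw [← le_div_iff₀ hT]; exact Nat.floor_le ht₀
  have hn2 : t - t₀ < (n + 1) * T := by
    rw [← div_lt_iff₀ hT]; exact Nat.lt_floor_add_one _
  have hNn : N ≤ n := by
    apply Nat.le_floor
    rw [le_div_iff₀ hT]
    linarith
  have h1 := hiter n (t - n * T) ⟨by linarith, by linarith⟩
  rw [sub_add_cancel] at h1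
  have := hN n hNn
  linarith

end Iteration

/-! ### Contraction over one window of excitation -/

section Window

/-- The real arithmetic of a window. `r` and `r'` are the error norms at its ends, `D = ∫ s²`, `N =
∫ |s|`, and `Q` and `δ` bound the mismatch and the drift of the true parameter. The constants
precede all of these, so they do not depend on the size `l` of the perturbation. -/
theorem exists_window_constants {γ R k T α₁ : ℝ} (hγ : 0 < γ) (hR : 0 < R) (hk : 0 < k)
    (hT : 0 < T) (hα₁ : 0 < α₁) :
    ∃ κ C : ℝ, 0 < κ ∧ κ < 1 ∧ 0 < C ∧ ∀ D N r r' Q δ l : ℝ, 0 ≤ r → 0 ≤ Q → 0 ≤ δ →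
      Q ≤ k * l → δ ≤ l → N ^ 2 ≤ T * D →
      α₁ * r ^ 2 ≤ 2 * D + 2 * R ^ 2 * T * ((γ * R * Q + δ) * T + γ * R * N) ^ 2 →
      r' ^ 2 - r ^ 2 ≤
        -γ * D + γ * Q ^ 2 * T + 2 * δ * T * (r + ((γ * R * Q + δ) * T + γ * R * N)) →
      r' ^ 2 ≤ (1 - κ) * r ^ 2 + C * l ^ 2 := by
  -- After the displacement is eliminated, `A` is the coefficient of `D` in the excitation bound.
  -- One half of `γ D` then yields `2 X r²`, one `X r²` of which absorbs the term `δ r`; `ω` is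
  -- chosen so that the other half absorbs the `D` part of `2 ω G²`. The minimum with `1 / 2` only
  -- secures `κ < 1`.
  obtain ⟨A, hA⟩ : ∃ A, A = 2 + 4 * R ^ 4 * γ ^ 2 * T ^ 2 := ⟨_, rfl⟩
  obtain ⟨X, hX⟩ : ∃ X, X = γ * α₁ / (4 * A) := ⟨_, rfl⟩
  obtain ⟨ω, hω⟩ : ∃ ω, ω = 1 / (8 * γ * R ^ 2 * T) := ⟨_, rfl⟩
  obtain ⟨p, hp⟩ : ∃ p, p = γ * R * k + 1 := ⟨_, rfl⟩
  have hA0 : 0 < A := by rw [hA]; positivity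
  have hX0 : 0 < X := by rw [hX]; positivity
  have hω0 : 0 < ω := by rw [hω]; positivity
  have hp0 : 0 < p := by rw [hp]; positivity
  refine ⟨min X (1 / 2), γ * R ^ 2 * T ^ 3 / A * 2 * p ^ 2 + γ * k ^ 2 * T + T ^ 2 / X + T ^ 2 / (2 * ω)
    + 4 * ω * T ^ 2 * p ^ 2, by positivity, by
      have := min_le_right X (1 / 2); linarith, by positivity, ?_⟩
  intro D N r r' Q δ l hr hQ hδ hQl hδl hN hexc hdiss
  obtain ⟨P, hP⟩ : ∃ P, P = γ * R * Q + δ := ⟨_, rfl⟩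
  obtain ⟨G, hG⟩ : ∃ G, G = P * T + γ * R * N := ⟨_, rfl⟩
  rw [← hP, ← hG] at hexc hdiss
  have hl : 0 ≤ l := hδ.trans hδl
  have hP0 : 0 ≤ P := by rw [hP]; positivity
  have hPp : P ≤ p * l := by
    have : γ * R * Q ≤ γ * R * (k * l) := by gcongr
    rw [hP, hp]; linarith
  have hP2 : P ^ 2 ≤ p ^ 2 * l ^ 2 := by rw [← mul_pow]; gcongr
  have hQ2 : Q ^ 2 ≤ k ^ 2 * l ^ 2 := by rw [← mul_pow]; gcongr
  have hδ2 : δ ^ 2 ≤ l ^ 2 := by gcongr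
  have hD : 0 ≤ D := by
    by_contra! h
    nlinarith [sq_nonneg N]
  have hG2 : G ^ 2 ≤ 2 * T ^ 2 * P ^ 2 + 2 * γ ^ 2 * R ^ 2 * T * D := by
    have h1 : G ^ 2 ≤ 2 * (P * T) ^ 2 + 2 * (γ * R * N) ^ 2 := by
      rw [hG]; nlinarith [sq_nonneg (P * T - γ * R * N)]
    have h2 : γ ^ 2 * R ^ 2 * N ^ 2 ≤ γ ^ 2 * R ^ 2 * (T * D) := by gcongr
    linarith
  have hexc2 : α₁ * r ^ 2 ≤ A * D + 4 * R ^ 2 * T ^ 3 * P ^ 2 := by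
    have : 2 * R ^ 2 * T * G ^ 2 ≤
      2 * R ^ 2 * T * (2 * T ^ 2 * P ^ 2 + 2 * γ ^ 2 * R ^ 2 * T * D) := by gcongr
    rw [hA]; linarith
  -- half of the dissipation controls `r ^ 2`
  have hXr : 2 * X * r ^ 2 ≤ γ / 2 * D + γ * R ^ 2 * T ^ 3 / A * 2 * P ^ 2 := by
    have h1 : γ / (2 * A) * (α₁ * r ^ 2) ≤ γ / (2 * A) * (A * D + 4 * R ^ 2 * T ^ 3 * P ^ 2) := by
      gcongr
    have h2 : γ / (2 * A) * (α₁ * r ^ 2) = 2 * X * r ^ 2 := by rw [hX]; field_simp; ring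
    have h3 : γ / (2 * A) * (A * D + 4 * R ^ 2 * T ^ 3 * P ^ 2)
      = γ / 2 * D + γ * R ^ 2 * T ^ 3 / A * 2 * P ^ 2 := by field_simp; ring
    linarith
  have hδr : 2 * δ * T * r ≤ X * r ^ 2 + T ^ 2 / X * δ ^ 2 := by
    have h1 : 0 ≤ (X * r - T * δ) ^ 2 / X := by positivity
    have h2 : (X * r - T * δ) ^ 2 / X = X * r ^ 2 + T ^ 2 / X * δ ^ 2 - 2 * δ * T * r := by
      field_simp; ring
    linarith
  have hδG : 2 * δ * T * G ≤ 2 * ω * G ^ 2 + T ^ 2 / (2 * ω) * δ ^ 2 := by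
    have h1 : 0 ≤ (2 * ω * G - T * δ) ^ 2 / (2 * ω) := by positivity
    have h2 : (2 * ω * G - T * δ) ^ 2 / (2 * ω)
      = 2 * ω * G ^ 2 + T ^ 2 / (2 * ω) * δ ^ 2 - 2 * δ * T * G := by
      field_simp; ring
    linarith
  have hωG : 2 * ω * G ^ 2 ≤ 4 * ω * T ^ 2 * P ^ 2 + γ / 2 * D := by
    have h1 : 2 * ω * G ^ 2 ≤ 2 * ω * (2 * T ^ 2 * P ^ 2 + 2 * γ ^ 2 * R ^ 2 * T * D) := by gcongr
    have h2 : 2 * ω * (2 * γ ^ 2 * R ^ 2 * T * D) = γ / 2 * D := by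
      rw [hω]; field_simp; ring
    linarith
  have hmin : min X (1 / 2) * r ^ 2 ≤ X * r ^ 2 := by
    gcongr; exact min_le_left _ _
  have e1 : γ * R ^ 2 * T ^ 3 / A * 2 * P ^ 2 ≤ γ * R ^ 2 * T ^ 3 / A * 2 * (p ^ 2 * l ^ 2) := by gcongr
  have e2 : γ * T * Q ^ 2 ≤ γ * T * (k ^ 2 * l ^ 2) := by gcongr
  have e3 : T ^ 2 / X * δ ^ 2 ≤ T ^ 2 / X * l ^ 2 := by gcongr
  have e4 : T ^ 2 / (2 * ω) * δ ^ 2 ≤ T ^ 2 / (2 * ω) * l ^ 2 := by gcongr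
  have e5 : 4 * ω * T ^ 2 * P ^ 2 ≤ 4 * ω * T ^ 2 * (p ^ 2 * l ^ 2) := by gcongr
  linarith

theorem sq_integral_le {f : ℝ → ℝ} {t T : ℝ} (hT : 0 < T) (hf : ContinuousOn f (Icc t (t + T))) :
    (∫ τ in t..(t + T), f τ) ^ 2 ≤ T * ∫ τ in t..(t + T), f τ ^ 2 := by
  have htT : t ≤ t + T := by linarith
  have hi : IntervalIntegrable f volume t (t + T) := hf.intervalIntegrable_of_Icc htT
  have hi2 : IntervalIntegrable (fun τ => f τ ^ 2) volume t (t + T) :=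
    (hf.pow 2).intervalIntegrable_of_Icc htT
  set N := ∫ τ in t..(t + T), f τ with hN
  -- Cauchy–Schwarz, by expanding the integral of the squared deviation of `f` from its mean `N /
  -- T`.
  have h0 : 0 ≤ ∫ τ in t..(t + T), (f τ ^ 2 - 2 * (N / T) * f τ + (N / T) ^ 2) :=
    intervalIntegral.integral_nonneg htT fun τ _ => by nlinarith [sq_nonneg (f τ - N / T)]
  rw [intervalIntegral.integral_add (hi2.sub (hi.const_mul _)) (by simp),
    intervalIntegral.integral_sub hi2 (hi.const_mul _), intervalIntegral.integral_const_mul,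
    intervalIntegral.integral_const, ← hN, smul_eq_mul, add_sub_cancel_left] at h0
  have h1 : T * (2 * (N / T) * N) = 2 * N ^ 2 := by field_simp
  have h2 : T * (T * (N / T) ^ 2) = N ^ 2 := by field_simp
  have h3 := mul_nonneg hT.le h0
  linarith

/-- Over a window of persistent excitation, the error of a perturbed gradient law whose velocity is
dominated by the one without projection contracts up to the size of the perturbations. -/
theorem exists_contraction_of_excitation {γ R k T α₁ : ℝ} (hγ : 0 < γ) (hR : 0 < R) (hk : 0 < k)
    (hT : 0 < T) (hα₁ : 0 < α₁) :
    ∃ κ C : ℝ, 0 < κ ∧ κ < 1 ∧ 0 < C ∧ ∀ (E : Type) [NormedAddCommGroup E]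
      [InnerProductSpace ℝ E] (e φ : ℝ → E) (t Q δ l : ℝ), 0 ≤ Q → 0 ≤ δ → Q ≤ k * l → δ ≤ l →
      AbsolutelyContinuousOnInterval e t (t + T) → ContinuousOn φ (Icc t (t + T)) →
      (∀ τ ∈ Icc t (t + T), ‖φ τ‖ ≤ R) →
      α₁ * ‖e t‖ ^ 2 ≤ ∫ τ in t..(t + T), (inner ℝ (e t) (φ τ)) ^ 2 →
      (∀ᵐ τ, τ ∈ Icc t (t + T) → ∃ w, HasDerivAt e w τ ∧
        inner ℝ (e τ) w ≤ -γ * (inner ℝ (e τ) (φ τ)) ^ 2 + γ * |inner ℝ (e τ) (φ τ)| * Q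
          + δ * ‖e τ‖ ∧
        ‖w‖ ≤ γ * R * (Q + |inner ℝ (e τ) (φ τ)|) + δ) →
      ‖e (t + T)‖ ^ 2 ≤ (1 - κ) * ‖e t‖ ^ 2 + C * l ^ 2 := by
  obtain ⟨κ, C, hκ, hκ₁, hC, hconst⟩ := exists_window_constants hγ hR hk hT hα₁
  refine ⟨κ, C, hκ, hκ₁, hC, ?_⟩
  intro E _ _ e φ t Q δ l hQ hδ hQl hδl hac hφ hφR hexc hode
  have htT : t ≤ t + T := by linarith
  have hec : ContinuousOn e (Icc t (t + T)) := by simpa [uIcc_of_le htT] using hac.continuousOn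
  have hsc : ContinuousOn (fun τ => inner ℝ (e τ) (φ τ)) (Icc t (t + T)) := hec.inner hφ
  have hsi : IntervalIntegrable (fun τ => |inner ℝ (e τ) (φ τ)|) volume t (t + T) :=
    hsc.abs.intervalIntegrable_of_Icc htT
  have hs2i : IntervalIntegrable (fun τ => (inner ℝ (e τ) (φ τ)) ^ 2) volume t (t + T) :=
    (hsc.pow 2).intervalIntegrable_of_Icc htT
  set N := ∫ τ in t..(t + T), |inner ℝ (e τ) (φ τ)| with hN
  set D := ∫ τ in t..(t + T), (inner ℝ (e τ) (φ τ)) ^ 2 with hD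
  set G := (γ * R * Q + δ) * T + γ * R * N with hG
  have hND : N ^ 2 ≤ T * D := by
    simpa [sq_abs] using sq_integral_le hT hsc.abs
  have hmove : ∀ τ ∈ Icc t (t + T), ‖e τ - e t‖ ≤ G := by
    intro τ hτ
    have hsub : Icc t τ ⊆ Icc t (t + T) := Icc_subset_Icc_right hτ.2
    have hbound : IntervalIntegrable
        (fun τ => γ * R * (Q + |inner ℝ (e τ) (φ τ)|) + δ) volume t (t + T) :=
      (((continuousOn_const.add hsc.abs).const_smul (γ * R)).add
        continuousOn_const).intervalIntegrable_of_Icc htT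
    have h1 := (hac.mono (c := t) (d := τ) (by
      rwa [uIcc_of_le hτ.1, uIcc_of_le htT])).norm_sub_le_integral hτ.1
      (hbound.mono_set (by rwa [uIcc_of_le hτ.1, uIcc_of_le htT])) (by
        filter_upwards [hode] with u hu hmem
        obtain ⟨w, hw, -, hwn⟩ := hu (hsub hmem)
        exact ⟨w, hw, hwn⟩)
    refine h1.trans ?_
    have h2 : ∫ τ in t..τ, (γ * R * (Q + |inner ℝ (e τ) (φ τ)|) + δ) ≤
        ∫ τ in t..(t + T), (γ * R * (Q + |inner ℝ (e τ) (φ τ)|) + δ) := by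
      refine intervalIntegral.integral_mono_interval le_rfl hτ.1 hτ.2 ?_ hbound
      exact Eventually.of_forall fun u => by simp only [Pi.zero_apply]; positivity
    refine h2.trans_eq ?_
    have h3 : ∀ u, γ * R * (Q + |inner ℝ (e u) (φ u)|) + δ
        = γ * R * |inner ℝ (e u) (φ u)| + (γ * R * Q + δ) := fun u => by ring
    simp_rw [h3]
    rw [intervalIntegral.integral_add (hsi.const_mul _) (by simp),
      intervalIntegral.integral_const_mul, intervalIntegral.integral_const, smul_eq_mul, hG]
    ring
  have hG0 : 0 ≤ G := (norm_nonneg _).trans (hmove t ⟨le_rfl, htT⟩)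
  -- Excitation concerns the frozen vector `e t`, dissipation the moving `e τ`; replacing one by the
  -- other costs the displacement bound `G`.
  have hexc2 : α₁ * ‖e t‖ ^ 2 ≤ 2 * D + 2 * R ^ 2 * T * G ^ 2 := by
    refine hexc.trans ?_
    have h1 : ∫ τ in t..(t + T), (inner ℝ (e t) (φ τ)) ^ 2 ≤
        ∫ τ in t..(t + T), (2 * (inner ℝ (e τ) (φ τ)) ^ 2 + 2 * R ^ 2 * G ^ 2) := by
      refine intervalIntegral.integral_mono_on htT
        (((continuousOn_const.inner hφ).pow 2).intervalIntegrable_of_Icc htT)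
        ((hs2i.const_mul 2).add (by simp)) fun τ hτ => ?_
      have h2 : inner ℝ (e t) (φ τ) = inner ℝ (e τ) (φ τ) - inner ℝ (e τ - e t) (φ τ) := by
        rw [inner_sub_left]; ring
      have h3 : |inner ℝ (e τ - e t) (φ τ)| ≤ G * R :=
        (abs_real_inner_le_norm _ _).trans
          (mul_le_mul (hmove τ hτ) (hφR τ hτ) (norm_nonneg _) hG0)
      have h4 : (inner ℝ (e τ - e t) (φ τ)) ^ 2 ≤ (G * R) ^ 2 :=
        sq_le_sq' (abs_le.mp h3).1 (abs_le.mp h3).2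
      rw [h2]
      nlinarith [sq_nonneg (inner ℝ (e τ) (φ τ) + inner ℝ (e τ - e t) (φ τ))]
    refine h1.trans_eq ?_
    rw [intervalIntegral.integral_add (hs2i.const_mul _) (by simp),
      intervalIntegral.integral_const_mul, intervalIntegral.integral_const, smul_eq_mul]
    ring
  refine hconst D N ‖e t‖ ‖e (t + T)‖ Q δ l (norm_nonneg _) hQ hδ hQl hδl hND hexc2 ?_
  have hnac : AbsolutelyContinuousOnInterval (fun τ => ‖e τ‖) t (t + T) :=
    lipschitzWith_one_norm.comp_absolutelyContinuousOnInterval hac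
  have hVac := hnac.mul hnac
  have h1 := hVac.sub_le_integral htT
    (h := fun τ => -γ * (inner ℝ (e τ) (φ τ)) ^ 2 + (γ * Q ^ 2 + 2 * δ * (‖e t‖ + G)))
    ((hs2i.const_mul _).add (by simp)) (by
      filter_upwards [hode] with τ hτ hmem
      obtain ⟨w, hw, hwi, -⟩ := hτ hmem
      have h2 : HasDerivAt ((fun τ => ‖e τ‖) * fun τ => ‖e τ‖) (2 * inner ℝ (e τ) w) τ := by
        have := hw.norm_sq
        refine this.congr_of_eventuallyEq (Eventually.of_forall fun u => ?_)
        simp [sq]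
      rw [h2.deriv]
      have h3 : ‖e τ‖ ≤ ‖e t‖ + G := by
        have := norm_add_le (e t) (e τ - e t)
        rw [add_sub_cancel] at this
        linarith [hmove τ hmem]
      have h4 : δ * ‖e τ‖ ≤ δ * (‖e t‖ + G) := by gcongr
      -- Young's inequality `2 |s| Q ≤ s² + Q²` spends half of the dissipation `2 γ s²` on the
      -- mismatch.
      have h5 : 0 ≤ γ * (|inner ℝ (e τ) (φ τ)| - Q) ^ 2 := by positivity
      have h6 : |inner ℝ (e τ) (φ τ)| ^ 2 = (inner ℝ (e τ) (φ τ)) ^ 2 := sq_abs _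
      nlinarith)
  rw [intervalIntegral.integral_add (hs2i.const_mul _) (by simp),
      intervalIntegral.integral_const_mul, intervalIntegral.integral_const, smul_eq_mul] at h1
  simp only [Pi.mul_apply, ← sq, ← hD] at h1
  linarith

end Window

/-! ### The quadratic field in linear parametrization -/

section Model

variable {m : ℕ}

theorem inner_eq_hessPart_add_locPart (u v : ParamVec m) :
    inner ℝ u v = inner ℝ (hessPart u) (hessPart v) + inner ℝ (locPart u) (locPart v) := by
  simp only [PiLp.inner_apply, Fintype.sum_sum_type, hessPart, locPart]

theorem hessPart_sub (u v : ParamVec m) : hessPart (u - v) = hessPart u - hessPart v := by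
  ext; simp [hessPart]

theorem norm_sq_eq_hessPart_add_locPart (u : ParamVec m) :
    ‖u‖ ^ 2 = ‖hessPart u‖ ^ 2 + ‖locPart u‖ ^ 2 := by
  simp only [← real_inner_self_eq_norm_sq, inner_eq_hessPart_add_locPart]

theorem IsParamProj.norm_le {S : Set (HVec m)} {θ v w : ParamVec m} (h : IsParamProj S θ v w) :
    ‖w‖ ≤ ‖v‖ := by
  obtain ⟨h1, h2, h3⟩ := h
  refine le_of_sq_le_sq ?_ (norm_nonneg _)
  rw [norm_sq_eq_hessPart_add_locPart w, norm_sq_eq_hessPart_add_locPart v, h3]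
  have := norm_posTangentConeAt_proj_le h1 h2
  gcongr

/-- The part `v - w` removed by the projection has nonpositive inner product with `θ' - θ` on the
block `θ_H` and vanishes on `θ_x`. With `θ' = θ*`, the energy estimate of the unprojected law
survives. -/
theorem IsParamProj.inner_sub_le {S : Set (HVec m)} (hS : Convex ℝ S) {θ θ' v w : ParamVec m}
    (h : IsParamProj S θ v w) (hθ : hessPart θ ∈ S) (hθ' : hessPart θ' ∈ S) :
    inner ℝ (θ - θ') w ≤ inner ℝ (θ - θ') v := by
  obtain ⟨h1, h2, h3⟩ := h
  have h4 := hS.inner_sub_posTangentConeAt_proj_le hθ hθ' h1 h2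
  rw [inner_eq_hessPart_add_locPart, inner_eq_hessPart_add_locPart, h3, hessPart_sub]
  rw [← neg_sub (hessPart θ), inner_neg_right, real_inner_comm, inner_sub_right] at h4
  linarith

theorem hessPart_trueParam (H : Matrix (Fin m) (Fin m) ℝ) (x : EuclideanSpace ℝ (Fin m)) :
    hessPart (trueParam H x) = hessVec H := rfl

/-- The inclusion of the block `θ_x`. -/
def locEmbed (m : ℕ) : EuclideanSpace ℝ (Fin m) →ₗᵢ[ℝ] ParamVec m where
  toFun v := WithLp.toLp 2 (Sum.elim 0 v)
  map_add' u v := by ext i; cases i <;> simp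
  map_smul' c v := by ext i; cases i <;> simp
  norm_map' v := by
    simp [EuclideanSpace.norm_eq]

/-- The true parameter is affine in `x` and moves only in the block `θ_x`, so its speed is `‖H x'‖`.
-/
theorem trueParam_eq_add_locEmbed (H : Matrix (Fin m) (Fin m) ℝ) (x : EuclideanSpace ℝ (Fin m)) :
    trueParam H x = trueParam H 0 +
      locEmbed m (Matrix.toEuclideanCLM (n := Fin m) (𝕜 := ℝ) H x) := by
  ext i
  cases i <;> simp [trueParam, locEmbed]

theorem hasDerivAt_trueParam (H : Matrix (Fin m) (Fin m) ℝ) {x : ℝ → EuclideanSpace ℝ (Fin m)}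
    {x' : EuclideanSpace ℝ (Fin m)} {t : ℝ} (hx : HasDerivAt x x' t) :
    HasDerivAt (fun t => trueParam H (x t))
      (locEmbed m (Matrix.toEuclideanCLM (n := Fin m) (𝕜 := ℝ) H x')) t := by
  have h := ((locEmbed m).toContinuousLinearMap.comp
    (Matrix.toEuclideanCLM (n := Fin m) (𝕜 := ℝ) H)).hasFDerivAt.comp_hasDerivAt t hx
  have h2 := h.const_add (trueParam H 0)
  refine h2.congr_of_eventuallyEq (Eventually.of_forall fun s => ?_)
  exact trueParam_eq_add_locEmbed H (x s)

theorem sum_upperIdx (f : Fin m × Fin m → ℝ) :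
    ∑ p : UpperIdx m, f p.1 = ∑ i, ∑ j, if i ≤ j then f (i, j) else 0 := by
  rw [← Fintype.sum_prod_type' (f := fun i j => if i ≤ j then f (i, j) else 0),
    ← Finset.sum_filter]
  exact (Finset.sum_subtype (Finset.univ.filter fun p : Fin m × Fin m => p.1 ≤ p.2)
    (by simp) f).symm

theorem continuous_regressor : Continuous (regressor (m := m)) := by
  refine (PiLp.continuous_toLp 2 _).comp (continuous_pi fun i => ?_)
  rcases i with p | i
  · simp only [Sum.elim_inl]
    split_ifs <;> fun_prop
  · simp only [Sum.elim_inr]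
    fun_prop

/-- Extending the sum over `i ≤ j` to all pairs gives `‖y‖⁴`. The bound is free of `m`, which keeps
the final constant free of the dimension. -/
theorem norm_regressor_le (y : EuclideanSpace ℝ (Fin m)) : ‖regressor y‖ ≤ ‖y‖ ^ 2 + ‖y‖ := by
  refine le_of_sq_le_sq ?_ (by positivity)
  have h1 : ‖hessPart (regressor y)‖ ^ 2 ≤ ‖y‖ ^ 4 := by
    have h2 : ‖hessPart (regressor y)‖ ^ 2
        ≤ ∑ p : UpperIdx m, (y p.1.1 * y p.1.2) ^ 2 := by
      rw [EuclideanSpace.real_norm_sq_eq]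
      refine Finset.sum_le_sum fun p _ => ?_
      simp only [hessPart, regressor, Sum.elim_inl]
      split_ifs with h
      · rw [← h]; nlinarith [sq_nonneg (y p.1.1 ^ 2)]
      · rw [neg_sq]
    refine h2.trans ?_
    rw [sum_upperIdx fun p => (y p.1 * y p.2) ^ 2]
    calc ∑ i, ∑ j, (if i ≤ j then (y i * y j) ^ 2 else 0)
        ≤ ∑ i, ∑ j, y i ^ 2 * y j ^ 2 := by
          refine Finset.sum_le_sum fun i _ => Finset.sum_le_sum fun j _ => ?_
          split_ifs
          · rw [mul_pow]
          · positivity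
      _ = ‖y‖ ^ 4 := by
          rw [← Finset.sum_mul_sum, ← EuclideanSpace.real_norm_sq_eq]; ring
  have h3 : ‖locPart (regressor y)‖ = ‖y‖ := rfl
  rw [norm_sq_eq_hessPart_add_locPart, h3]
  have := norm_nonneg y
  nlinarith [pow_nonneg this 3]

theorem inner_trueParam_regressor {H : Matrix (Fin m) (Fin m) ℝ} (hH : H.IsSymm)
    (x y : EuclideanSpace ℝ (Fin m)) :
    inner ℝ (trueParam H x) (regressor y) =
      -(1 / 2) * inner ℝ y (Matrix.toEuclideanCLM (n := Fin m) (𝕜 := ℝ) H y)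
        + inner ℝ y (Matrix.toEuclideanCLM (n := Fin m) (𝕜 := ℝ) H x) := by
  rw [inner_eq_hessPart_add_locPart]
  congr 1
  · have h1 : inner ℝ (hessPart (trueParam H x)) (hessPart (regressor y)) =
        ∑ i, ∑ j, if i ≤ j then (if i = j then -(1 / 2) * (H i j * y i * y j)
          else -(H i j * y i * y j)) else 0 := by
      rw [PiLp.inner_apply, ← sum_upperIdx fun p : Fin m × Fin m =>
        if p.1 = p.2 then -(1 / 2) * (H p.1 p.2 * y p.1 * y p.2)
          else -(H p.1 p.2 * y p.1 * y p.2)]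
      refine Finset.sum_congr rfl fun p _ => ?_
      simp only [hessPart, trueParam, regressor, Sum.elim_inl, RCLike.inner_apply, conj_trivial]
      split_ifs with h
      · rw [← h]; ring
      · ring
    have h2 : inner ℝ y (Matrix.toEuclideanCLM (n := Fin m) (𝕜 := ℝ) H y)
        = ∑ i, ∑ j, H i j * y i * y j := by
      rw [Matrix.inner_toEuclideanCLM]
      simp only [dotProduct, Matrix.mulVec, Finset.mul_sum]
      exact Finset.sum_congr rfl fun i _ => Finset.sum_congr rfl fun j _ => by ring
    -- By symmetry the strictly lower triangle equals the strictly upper one, which is why `Ψ` has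
    -- the factor `1 / 2` only on the diagonal.
    have h3 : ∑ i, ∑ j, (if i < j then H i j * y i * y j else 0)
        = ∑ i, ∑ j, (if j < i then H i j * y i * y j else 0) := by
      rw [Finset.sum_comm]
      refine Finset.sum_congr rfl fun i _ => Finset.sum_congr rfl fun j _ => ?_
      rw [hH.apply i j, mul_right_comm]
    have h4 : ∑ i, ∑ j, H i j * y i * y j =
        ∑ i, ∑ j, (if i ≤ j then H i j * y i * y j else 0)
          + ∑ i, ∑ j, (if i < j then H i j * y i * y j else 0) := by
      rw [h3]
      simp only [← Finset.sum_add_distrib]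
      refine Finset.sum_congr rfl fun i _ => Finset.sum_congr rfl fun j _ => ?_
      rcases le_or_gt i j with h | h
      · simp [h, h.not_gt]
      · simp [h, h.not_ge]
    rw [h1, h2, h4]
    simp only [← Finset.sum_add_distrib, Finset.mul_sum]
    refine Finset.sum_congr rfl fun i _ => Finset.sum_congr rfl fun j _ => ?_
    rcases lt_trichotomy i j with h | h | h
    · simp [h, h.le, h.ne]; ring
    · simp [h]
    · simp [h.not_ge, h.not_gt]
  · rw [real_inner_comm]
    rfl

/-- The two cross terms of the expanded quadratic form agree by symmetry of `H`. The remainder is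
free of `y`, hence slowly varying. -/
theorem signalField_eq {H : Matrix (Fin m) (Fin m) ℝ} (hH : H.IsSymm) (c₁ : ℝ)
    (x y : EuclideanSpace ℝ (Fin m)) :
    signalField c₁ H x y = inner ℝ (trueParam H x) (regressor y)
      + (c₁ - 1 / 2 * inner ℝ x (Matrix.toEuclideanCLM (n := Fin m) (𝕜 := ℝ) H x)) := by
  have h1 : inner ℝ x (Matrix.toEuclideanCLM (n := Fin m) (𝕜 := ℝ) H y)
      = inner ℝ y (Matrix.toEuclideanCLM (n := Fin m) (𝕜 := ℝ) H x) := by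
    rw [Matrix.inner_toEuclideanCLM, Matrix.inner_toEuclideanCLM, Matrix.dotProduct_mulVec,
      ← Matrix.mulVec_transpose, hH.eq, dotProduct_comm]
  rw [inner_trueParam_regressor hH, signalField, ← Matrix.inner_toEuclideanCLM, map_sub,
    inner_sub_left, inner_sub_right, inner_sub_right, h1]
  ring

theorem IsPersistentlyExciting.le_integral {φ : ℝ → ParamVec m} {T α₁ α₂ : ℝ}
    (h : IsPersistentlyExciting φ T α₁ α₂) (hT : 0 < T) {t : ℝ} (ht : 0 ≤ t)
    (hφ : ContinuousOn φ (Icc t (t + T))) (v : ParamVec m) :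
    α₁ * ‖v‖ ^ 2 ≤ ∫ τ in t..(t + T), (inner ℝ v (φ τ)) ^ 2 := by
  have htT : t ≤ t + T := by linarith
  have h1 := (h t ht).1.dotProduct_mulVec_nonneg v.ofLp
  have hcomp : ∀ i, ContinuousOn (fun τ => φ τ i) (Icc t (t + T)) := fun i =>
    (PiLp.continuous_apply 2 _ i).comp_continuousOn hφ
  have hint : ∀ i j, IntervalIntegrable (fun τ => v i * v j * (φ τ i * φ τ j)) volume t (t + T) :=
    fun i j => (continuousOn_const.mul ((hcomp i).mul (hcomp j))).intervalIntegrable_of_Icc htT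
  have h2 : ∫ τ in t..(t + T), (inner ℝ v (φ τ)) ^ 2
      = v.ofLp ⬝ᵥ (gramMatrix φ T t).mulVec v.ofLp := by
    have h3 : ∀ τ, (inner ℝ v (φ τ)) ^ 2 = ∑ i, ∑ j, v i * v j * (φ τ i * φ τ j) := by
      intro τ
      rw [PiLp.inner_apply, sq, Finset.sum_mul_sum]
      refine Finset.sum_congr rfl fun i _ => Finset.sum_congr rfl fun j _ => ?_
      simp only [RCLike.inner_apply, conj_trivial]
      ring
    simp_rw [h3]
    have hint' : ∀ i, IntervalIntegrable (fun τ => ∑ j, v i * v j * (φ τ i * φ τ j))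
        volume t (t + T) := fun i => by
      simpa only [Finset.sum_fn] using IntervalIntegrable.sum Finset.univ fun j _ => hint i j
    rw [intervalIntegral.integral_finsetSum fun i _ => hint' i]
    simp only [dotProduct, Matrix.mulVec, Finset.mul_sum]
    refine Finset.sum_congr rfl fun i _ => ?_
    rw [intervalIntegral.integral_finsetSum fun j _ => hint i j]
    refine Finset.sum_congr rfl fun j _ => ?_
    rw [intervalIntegral.integral_const_mul, gramMatrix, Matrix.of_apply]
    ring
  rw [h2]
  have h4 : v.ofLp ⬝ᵥ v.ofLp = ‖v‖ ^ 2 := by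
    rw [EuclideanSpace.real_norm_sq_eq, dotProduct]
    exact Finset.sum_congr rfl fun i _ => by ring
  simp only [star_trivial, Matrix.sub_mulVec, Matrix.smul_mulVec, Matrix.one_mulVec,
    dotProduct_sub, dotProduct_smul, h4, smul_eq_mul] at h1
  linarith

end Model

/-! ### The filtered signals and the measurement mismatch -/

section Signals

variable {m : ℕ}

theorem IsFilterState.continuousOn {E : Type*} [NormedAddCommGroup E] [NormedSpace ℝ E] {a : ℝ}
    {u ξ : ℝ → E} (h : IsFilterState a u ξ) : ContinuousOn ξ (Ici 0) :=
  fun t ht => (h.2 t ht).continuousWithinAt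

theorem IsFilterState.norm_le {E : Type*} [NormedAddCommGroup E] [NormedSpace ℝ E] {a b : ℝ}
    (ha : 0 < a) {u ξ : ℝ → E} (h : IsFilterState a u ξ) (hu : ∀ t, 0 ≤ t → ‖u t‖ ≤ b) {t : ℝ}
    (ht : 0 ≤ t) : ‖ξ t‖ ≤ b / a := by
  simpa [h.1] using norm_le_of_stable_filter ha h.2 hu ht

theorem IsFilterState.norm_filterOutput_le {E : Type*} [NormedAddCommGroup E] [NormedSpace ℝ E]
    {a b : ℝ} (ha : 0 < a) {u ξ : ℝ → E} (h : IsFilterState a u ξ)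
    (hu : ∀ t, 0 ≤ t → ‖u t‖ ≤ b) {t : ℝ} (ht : 0 ≤ t) : ‖filterOutput a u ξ t‖ ≤ 2 * b := by
  have h1 : ‖-a • ξ t‖ ≤ b := by
    rw [norm_smul, norm_neg, Real.norm_of_nonneg ha.le]
    have := h.norm_le ha hu ht
    rwa [le_div_iff₀ ha, mul_comm] at this
  have h2 := norm_add_le (-a • ξ t) (u t)
  have h3 := hu t ht
  rw [filterOutput]
  linarith

/-- The filtered measurement differs from `θ*ᵀ φ` by a decaying term and one of the size of the
source speed. -/
theorem abs_filterOutput_sub_inner_le {H : Matrix (Fin m) (Fin m) ℝ} (hH : H.IsSymm)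
    {a c₁ ε M R : ℝ} (ha : 0 < a) (hM : 0 ≤ M) (hε : 0 ≤ ε)
    {x y : ℝ → EuclideanSpace ℝ (Fin m)} (hx : Differentiable ℝ x)
    (hxM : ∀ t, ‖x t‖ ≤ M) (hxε : ∀ t, ‖deriv x t‖ ≤ ε)
    (hy : ∀ t, ‖regressor (y t)‖ ≤ R) {ξ₁ : ℝ → ℝ} {ξ₂ : ℝ → ParamVec m}
    (hξ₁ : IsFilterState a (fun t => signalField c₁ H (x t) (y t)) ξ₁)
    (hξ₂ : IsFilterState a (fun t => regressor (y t)) ξ₂) :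
    ∃ B : ℝ, ∀ t, 0 ≤ t →
      |filterOutput a (fun t => signalField c₁ H (x t) (y t)) ξ₁ t
        - inner ℝ (trueParam H (x t)) (filterOutput a (fun t => regressor (y t)) ξ₂ t)|
      ≤ Real.exp (-(a * t)) * B
        + (M + R) * (‖Matrix.toEuclideanCLM (n := Fin m) (𝕜 := ℝ) H‖ * ε) / a := by
  set L := Matrix.toEuclideanCLM (n := Fin m) (𝕜 := ℝ) H with hL
  -- With `p = c₁ - xᵀ H x / 2`, the mismatch is `q = p - a (ξ₁ - θ*ᵀ ξ₂)`. It solves `q' = -a q +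
  -- p' + a θ*'ᵀ ξ₂`, whose forcing is of order `‖H‖ ε`; `c₁` enters only through `q 0`.
  set q : ℝ → ℝ := fun t => (c₁ - 1 / 2 * inner ℝ (x t) (L (x t)))
    - a * (ξ₁ t - inner ℝ (trueParam H (x t)) (ξ₂ t)) with hq
  refine ⟨‖q 0‖, fun t ht => ?_⟩
  have hLx : ∀ t, ‖L (x t)‖ ≤ ‖L‖ * M := fun t =>
    (L.le_opNorm _).trans (by gcongr; exact hxM t)
  have hLx' : ∀ t, ‖L (deriv x t)‖ ≤ ‖L‖ * ε := fun t =>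
    (L.le_opNorm _).trans (by gcongr; exact hxε t)
  have key := norm_le_of_stable_filter ha (q := q)
    (h := fun t => -(1 / 2) * (inner ℝ (x t) (L (deriv x t)) + inner ℝ (deriv x t) (L (x t)))
      + a * inner ℝ (locEmbed m (L (deriv x t))) (ξ₂ t))
    (b := (M + R) * (‖L‖ * ε)) ?_ ?_ ht
  · have hqt : q t = filterOutput a (fun t => signalField c₁ H (x t) (y t)) ξ₁ t
        - inner ℝ (trueParam H (x t)) (filterOutput a (fun t => regressor (y t)) ξ₂ t) := by
      simp only [hq, filterOutput, signalField_eq hH, inner_add_right, inner_smul_right, smul_eq_mul]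
      ring
    rwa [← hqt]
  · intro t ht
    have hx' := (hx t).hasDerivAt
    have h1 : HasDerivAt (fun t => inner ℝ (x t) (L (x t)))
        (inner ℝ (x t) (L (deriv x t)) + inner ℝ (deriv x t) (L (x t))) t :=
      hx'.inner ℝ (L.hasFDerivAt.comp_hasDerivAt t hx')
    have h2 := (hasDerivAt_trueParam H hx').hasDerivWithinAt.inner ℝ (hξ₂.2 t ht)
    have h3 := ((h1.const_mul (1 / 2)).const_sub c₁).hasDerivWithinAt.sub
      (((hξ₁.2 t ht).sub h2).const_mul a)
    refine h3.congr_deriv ?_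
    simp only [hq, signalField_eq hH, inner_add_right, inner_smul_right, smul_eq_mul, ← hL]
    ring
  · intro t ht
    have h1 : |inner ℝ (x t) (L (deriv x t))| ≤ M * (‖L‖ * ε) :=
      (abs_real_inner_le_norm _ _).trans
        (mul_le_mul (hxM t) (hLx' t) (norm_nonneg _) hM)
    have h2 : |inner ℝ (deriv x t) (L (x t))| ≤ ε * (‖L‖ * M) :=
      (abs_real_inner_le_norm _ _).trans
        (mul_le_mul (hxε t) (hLx t) (norm_nonneg _) hε)
    have h3 : |a * inner ℝ (locEmbed m (L (deriv x t))) (ξ₂ t)| ≤ R * (‖L‖ * ε) := by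
      rw [abs_mul, abs_of_pos ha]
      have h4 : |inner ℝ (locEmbed m (L (deriv x t))) (ξ₂ t)| ≤ (‖L‖ * ε) * (R / a) := by
        refine (abs_real_inner_le_norm _ _).trans ?_
        rw [LinearIsometry.norm_map]
        exact mul_le_mul (hLx' t) (hξ₂.norm_le ha (fun t _ => hy t) ht) (norm_nonneg _)
          (by positivity)
      calc _ ≤ a * ((‖L‖ * ε) * (R / a)) := by gcongr
        _ = _ := by field_simp
    rw [Real.norm_eq_abs]
    rw [abs_le] at *
    constructor <;> linarith

theorem lipschitzWith_trueParam (H : Matrix (Fin m) (Fin m) ℝ) {ε : ℝ} (hε : 0 ≤ ε)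
    {x : ℝ → EuclideanSpace ℝ (Fin m)} (hx : Differentiable ℝ x) (hxε : ∀ t, ‖deriv x t‖ ≤ ε) :
    LipschitzWith (‖Matrix.toEuclideanCLM (n := Fin m) (𝕜 := ℝ) H‖ * ε).toNNReal
      (fun t => trueParam H (x t)) := by
  refine lipschitzWith_of_nnnorm_deriv_le
    (fun t => (hasDerivAt_trueParam H (hx t).hasDerivAt).differentiableAt) fun t => ?_
  rw [(hasDerivAt_trueParam H (hx t).hasDerivAt).deriv]
  rw [Real.le_toNNReal_iff_coe_le (by positivity), coe_nnnorm, LinearIsometry.norm_map]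
  exact (ContinuousLinearMap.le_opNorm _ _).trans (by gcongr; exact hxε t)

end Signals

/-! ### The tracking bound -/

/-- `K` is chosen before `m`, `H`, `S`, `c₁`, `M₃`, `ε` and the trajectories, which expresses what
it may depend on. The operator norm stands for `λ_max(H)`. The `limsup` is taken in `ENNReal`, where
it needs no boundedness condition. -/
theorem theorem2 (M₁ M₂ M₄ γ a T α₁ α₂ : ℝ) (hM₁ : 0 < M₁) (hM₂ : 0 < M₂) (hM₄ : 0 < M₄)
    (hγ : 0 < γ) (ha : 0 < a) (hT : 0 < T) (hα₁ : 0 < α₁) (hα₂ : 0 < α₂) :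
    ∃ K : ℝ, 0 < K ∧
      ∀ (m : ℕ) (H : Matrix (Fin m) (Fin m) ℝ) (c₁ : ℝ) (S : Set (HVec m)) (M₃ ε : ℝ)
        (x y : ℝ → EuclideanSpace ℝ (Fin m)) (ξ₁ : ℝ → ℝ) (ξ₂ θhat : ℝ → ParamVec m),
        -- the signal field and the projection set
        0 < c₁ → H.IsSymm → IsPosDiagDominant H →
        Convex ℝ S → (∀ v ∈ S, IsPosDiagDominant (symmMatrix v)) → hessVec H ∈ S →
        -- the bounds on the trajectories of the agent and of the source
        0 < M₃ → 0 < ε →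
        Differentiable ℝ y → Differentiable ℝ (deriv y) → Differentiable ℝ x →
        (∀ t, ‖y t‖ ≤ M₁) → (∀ t, ‖deriv y t‖ ≤ M₂) → (∀ t, ‖deriv (deriv y) t‖ ≤ M₃) →
        (∀ t, ‖x t‖ ≤ M₄) → (∀ t, ‖deriv x t‖ ≤ ε) →
        -- the filters
        IsFilterState a (fun t => signalField c₁ H (x t) (y t)) ξ₁ →
        IsFilterState a (fun t => regressor (y t)) ξ₂ →
        -- persistent excitation
        IsPersistentlyExciting (filterOutput a (fun t => regressor (y t)) ξ₂) T α₁ α₂ →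
        -- the adaptive law with parameter projection
        IsProjectedGradientSolution γ S
          (filterOutput a (fun t => signalField c₁ H (x t) (y t)) ξ₁)
          (filterOutput a (fun t => regressor (y t)) ξ₂) θhat →
        limsup (fun t => ‖θhat t - trueParam H (x t)‖ₑ) atTop ≤
          ENNReal.ofReal (K * ‖Matrix.toEuclideanCLM (n := Fin m) (𝕜 := ℝ) H‖ * ε) := by
  obtain ⟨R, hR⟩ : ∃ R, R = M₁ ^ 2 + M₁ := ⟨_, rfl⟩
  have hR0 : 0 < R := by rw [hR]; positivity
  -- `(M₄ + R) / a` comes from the forcing of the mismatch; the extra `1 / a` leaves room for its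
  -- transient, eventually at most `η / a`.
  obtain ⟨k, hk⟩ : ∃ k, k = (M₄ + R + 1) / a := ⟨_, rfl⟩
  have hk0 : 0 < k := by rw [hk]; positivity
  -- The factor `2` arises because the output `-a ξ + u` of a filter can reach twice the bound of
  -- its input.
  obtain ⟨κ, C, hκ, hκ₁, hC, hcontr⟩ :=
    exists_contraction_of_excitation hγ (mul_pos two_pos hR0) hk0 hT hα₁
  refine ⟨√(C / κ + 1), by positivity, ?_⟩
  intro m H c₁ S M₃ ε x y ξ₁ ξ₂ θhat _ hH _ hS _ hHS _ hε hy _ hx hyM _ _ hxM hxε hξ₁ hξ₂ hPE hθ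
  set φ := filterOutput a (fun t => regressor (y t)) ξ₂
  set z := filterOutput a (fun t => signalField c₁ H (x t) (y t)) ξ₁
  set lam := ‖Matrix.toEuclideanCLM (n := Fin m) (𝕜 := ℝ) H‖
  have hΨ : ∀ t, ‖regressor (y t)‖ ≤ R := fun t => by
    rw [hR]
    refine (norm_regressor_le _).trans ?_
    have := hyM t
    gcongr
  have hφR : ∀ t, 0 ≤ t → ‖φ t‖ ≤ 2 * R := fun t ht =>
    hξ₂.norm_filterOutput_le ha (fun t _ => hΨ t) ht
  have hφc : ContinuousOn φ (Ici 0) :=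
    (hξ₂.continuousOn.const_smul (-a)).add (continuous_regressor.comp hy.continuous).continuousOn
  obtain ⟨B, hB⟩ := abs_filterOutput_sub_inner_le hH ha hM₄.le hε.le hx hxM hxε hΨ hξ₁ hξ₂
  set e : ℝ → ParamVec m := fun t => θhat t - trueParam H (x t) with he
  have hlam0 : 0 ≤ lam * ε := by positivity
  have heac : ∀ b, 0 ≤ b → AbsolutelyContinuousOnInterval e 0 b := fun b hb =>
    (hθ.absCont b hb).sub
      (lipschitzWith_trueParam H hε.le hx hxε).lipschitzOnWith.absolutelyContinuousOnInterval
  -- The slack `η` absorbs the transient and keeps `l` positive even when `‖H‖ = 0`, which happens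
  -- for `m = 0`.
  have hev : ∀ η : ℝ, 0 < η → ∀ᶠ t in atTop, ‖e t‖ ≤ √(C / κ + 1) * (lam * ε + η) := by
    intro η hη
    have hdecay : Tendsto (fun t => Real.exp (-(a * t)) * B) atTop (𝓝 0) := by
      simpa using (Real.tendsto_exp_neg_atTop_nhds_zero.comp
        (tendsto_id.const_mul_atTop ha)).mul_const B
    obtain ⟨t₀, ht₀, hsmall⟩ : ∃ t₀, 0 ≤ t₀ ∧ ∀ t, t₀ ≤ t → Real.exp (-(a * t)) * B ≤ η / a := by
      obtain ⟨t₁, ht₁⟩ := eventually_atTop.mp (hdecay.eventually_le_const (div_pos hη ha))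
      exact ⟨max t₁ 0, le_max_right _ _, fun t ht => ht₁ t ((le_max_left _ _).trans ht)⟩
    set l := lam * ε + η with hl
    have hl0 : 0 < l := by positivity
    have hq : ∀ t, t₀ ≤ t → |z t - inner ℝ (trueParam H (x t)) (φ t)| ≤ k * l := by
      intro t ht
      refine (hB t (ht₀.trans ht)).trans ((add_le_add_left (hsmall t ht) _).trans ?_)
      rw [hk, hl, ← add_div, div_mul_eq_mul_div]
      gcongr
      nlinarith [mul_nonneg (add_nonneg hM₄.le hR0.le) hη.le]
    have hsq : ∀ t, t₀ ≤ t → ‖e (t + T)‖ ^ 2 ≤ (1 - κ) * ‖e t‖ ^ 2 + C * l ^ 2 := by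
      intro t ht
      have ht0 : 0 ≤ t := ht₀.trans ht
      have htT : t ≤ t + T := by linarith
      have hsub : Icc t (t + T) ⊆ Ici 0 := fun τ hτ => ht0.trans hτ.1
      refine hcontr (ParamVec m) e φ t (k * l) (lam * ε) l (by positivity) hlam0 le_rfl
        (by linarith) ((heac (t + T) (by linarith)).mono ?_) (hφc.mono hsub)
        (fun τ hτ => hφR τ (hsub hτ)) (hPE.le_integral hT ht0 (hφc.mono hsub) (e t)) ?_
      · rw [uIcc_of_le htT, uIcc_of_le (by linarith)]
        exact Icc_subset_Icc_left ht0
      · filter_upwards [(ae_restrict_iff' measurableSet_Ici).mp hθ.ode] with τ hτ hmem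
        obtain ⟨w, hw, hproj⟩ := hτ (hsub hmem)
        have hτ0 : 0 ≤ τ := hsub hmem
        have hqτ := hq τ (ht.trans hmem.1)
        have hd := hasDerivAt_trueParam H (hx τ).hasDerivAt
        set w' := locEmbed m (Matrix.toEuclideanCLM (n := Fin m) (𝕜 := ℝ) H (deriv x τ))
        have hw' : ‖w'‖ ≤ lam * ε := by
          rw [LinearIsometry.norm_map]
          exact (ContinuousLinearMap.le_opNorm _ _).trans (by gcongr; exact hxε τ)
        set s := inner ℝ (e τ) (φ τ) with hs
        set q := z τ - inner ℝ (trueParam H (x τ)) (φ τ) with hqdef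
        -- The residual that drives the law is the mismatch minus the error seen along `φ`.
        have hres : z τ - inner ℝ (θhat τ) (φ τ) = q - s := by
          rw [hs, he, hqdef, inner_sub_left]; ring
        rw [hres] at hproj
        refine ⟨w - w', hw.sub hd, ?_, ?_⟩
        · have h1 := hproj.inner_sub_le hS (hθ.mem τ hτ0)
            (by rw [hessPart_trueParam]; exact hHS : hessPart (trueParam H (x τ)) ∈ S)
          change inner ℝ (e τ) w ≤ inner ℝ (e τ) _ at h1
          rw [inner_smul_right, inner_smul_right, ← hs] at h1
          have h2 : -inner ℝ (e τ) w' ≤ lam * ε * ‖e τ‖ := by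
            have h3 := (neg_le_abs _).trans (abs_real_inner_le_norm (e τ) w')
            have h4 : ‖e τ‖ * ‖w'‖ ≤ ‖e τ‖ * (lam * ε) := by gcongr
            linarith
          have h3 : q * s ≤ |s| * (k * l) := by
            refine (le_abs_self _).trans ?_
            rw [abs_mul, mul_comm]
            gcongr
          have h4 : γ * (q * s) ≤ γ * (|s| * (k * l)) := by gcongr
          rw [inner_sub_right]
          linarith
        · have h1 := hproj.norm_le
          rw [norm_smul, norm_smul, Real.norm_of_nonneg hγ.le, Real.norm_eq_abs, ← mul_assoc] at h1
          have h2 : |q - s| ≤ k * l + |s| := (abs_sub q s).trans (by linarith)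
          have h3 : γ * |q - s| * ‖φ τ‖ ≤ γ * (k * l + |s|) * (2 * R) := by
            have := hφR τ hτ0
            gcongr
          have h4 := norm_sub_le w w'
          linarith
    have hbdd : BddAbove ((fun t => ‖e t‖ ^ 2) '' Icc t₀ (t₀ + T)) := by
      refine (isCompact_Icc.image_of_continuousOn ?_).bddAbove
      have h1 := (heac (t₀ + T) (by linarith)).continuousOn
      rw [uIcc_of_le (by linarith)] at h1
      exact ((h1.mono (Icc_subset_Icc_left ht₀)).norm).pow 2
    -- Taking `l ^ 2` as the tolerance keeps the bound homogeneous in `l`; this is the `+ 1` in `√(C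
    -- / κ + 1)`.
    filter_upwards [eventually_le_of_contracting_shift hT hκ hκ₁ hbdd hsq
      (show 0 < l ^ 2 by positivity)] with t ht
    refine le_of_sq_le_sq (ht.trans_eq ?_) (by positivity)
    rw [mul_pow, Real.sq_sqrt (by positivity)]
    ring
  have hlim : Tendsto (fun η : ℝ => ENNReal.ofReal (√(C / κ + 1) * (lam * ε + η))) (𝓝[>] 0)
      (𝓝 (ENNReal.ofReal (√(C / κ + 1) * lam * ε))) := by
    have h1 : Continuous fun η : ℝ => ENNReal.ofReal (√(C / κ + 1) * (lam * ε + η)) :=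
      ENNReal.continuous_ofReal.comp (by fun_prop)
    have h2 := h1.tendsto 0
    rw [add_zero, ← mul_assoc] at h2
    exact h2.mono_left nhdsWithin_le_nhds
  refine ge_of_tendsto hlim (eventually_nhdsWithin_of_forall fun η hη => ?_)
  refine limsup_le_of_le (by isBoundedDefault) ?_
  filter_upwards [hev η hη] with t ht
  rw [← ofReal_norm]
  exact ENNReal.ofReal_le_ofReal ht
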